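/- There is a constant $R_*>1$ such that for every $R_0\ge R_*$ the following holds with $\epsilon=\dfrac{1}{R_0^2\log R_0}$. There exist a bounded $C^\infty$ map $\mathbf U:\mathbb R^2\to\mathbb R^2$, a $C^\infty$ field $A=[A^{ij}_{\alpha\beta}]_{\alpha,\beta\le 2}^{i,j\le 2}$ on $\mathbb R^2$, a map $\mathbf u:\mathbb R^2\times(-\infty,0]\to\mathbb R^2$ and a coefficient field $a=[a^{ij}_{\alpha\beta}(x,t)]$ on $\mathbb R^2\times(-\infty,0]$ such that: 1. For all $x\in\mathbb R^2$ and $t<0$, $$\mathbf u(x,t)=(-t)^{-\epsilon/2}\,\mathbf U\!\left(\frac{x}{\sqrt{-t}}\right),\qquad a(x,t)=A\!\left(\frac{x}{\sqrt{-t}}\right).$$ 2. $\mathbf u$ is $C^\infty$ on $\{t<0\}$ and Lipschitz up to $t=0$ away from $(0,0)$: it is Lipschitz on $\mathbb R^2\times(-\infty,0]$ minus any neighborhood of $(0,0)$. 3. $a$ is bounded, symmetric ($a^{ij}_{\alpha\beta}=a^{ji}_{\beta\alpha}$) and uniformly elliptic on $\mathbb R^2\times(-\infty,0]$: there are $\lambda,\Lambda>0$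 with $\lambda|p|^2\le a^{ij}_{\alpha\beta}(x,t)p^\alpha_ip^\beta_j\le\Lambda|p|^2$ for all $(x,t)$ and all $p\in M^{2\times2}$. It is $C^\infty$ on $\{t<0\}$ and is discontinuous at $(0,0)$ (it has no limit there along $t<0$). 4. $\mathbf u$ is a weak solution of $\mathbf u_t=\operatorname{div}(a(x,t)D\mathbf u)$ in $\mathbb R^2\times(-\infty,0)$, that is, $\mathbf u,\,D\mathbf u\in L^2_{loc}(\mathbb R^2\times(-\infty,0))$ and $u^\alpha_t=\partial_i(a^{ij}_{\alpha\beta}u^\beta_j)$ in the sense of distributions for $\alpha=1,2$. 5. $\|\mathbf u(\cdot,t)\|_{L^\infty(B_1)}$ blows up at the rate $(-t)^{-\epsilon/2}$: there are $c,C>0$ with $c(-t)^{-\epsilon/2}\le\|\mathbf u(\cdot,t)\|_{L^\infty(B_1)}\le C(-t)^{-\epsilon/2}$ for all $t\in[-1,0)$. 6. $\mathbf u(\cdot,0)$ is homogeneous of degree $-\epsilon$, i.e. $\mathbf u(sx,0)=s^{-\epsilon}\mathbf u(x,0)$ for all $x\ne0$, $s>0$, and is discontinuous at $0$ (it has no limit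 as $x\to0$). -/

import Mathlib

open Set Filter Topology MeasureTheory
open scoped ContDiff

namespace ParabolicSystem

/-- Space-time `ℝⁿ × ℝ`; a point is written `p = (x, t)`. -/
abbrev SpaceTime (n : ℕ) := EuclideanSpace ℝ (Fin n) × ℝ

/-- Coefficient tensors: `a α β i j` is `a^{ij}_{αβ}` with `α, β ≤ m` and `i, j ≤ n`. -/
abbrev Coeff (m n : ℕ) := Fin m → Fin m → Fin n → Fin n → ℝ

/-- The domain `ℝⁿ × (-∞, 0)`. -/
def past (n : ℕ) : Set (SpaceTime n) := {p | p.2 < 0}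

/-- The domain `ℝⁿ × (-∞, 0]`. -/
def closedPast (n : ℕ) : Set (SpaceTime n) := {p | p.2 ≤ 0}

/-- The quadratic form `a^{ij}_{αβ} ξ^α_i ξ^β_j` on `m × n` matrices `ξ`. -/
def quadForm {m n : ℕ} (b : Coeff m n) (ξ : Matrix (Fin m) (Fin n) ℝ) : ℝ :=
  ∑ α, ∑ β, ∑ i, ∑ j, b α β i j * ξ α i * ξ β j

/-- The tensor is a symmetric bilinear form on `m × n` matrices. -/
def IsSymmCoeff {m n : ℕ} (b : Coeff m n) : Prop :=
  ∀ α β i j, b α β i j = b β α j i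

/-- Uniform ellipticity on `S`: `lam |ξ|² ≤ a^{ij}_{αβ} ξ^α_i ξ^β_j ≤ Lam |ξ|²` with positive constants
`lam`, `Lam` and the Euclidean norm of the matrix `ξ`. -/
def UniformlyElliptic {m n : ℕ} {X : Type*} (a : X → Coeff m n) (S : Set X) : Prop :=
  ∃ lam Lam : ℝ, 0 < lam ∧ 0 < Lam ∧ ∀ p ∈ S, ∀ ξ : Matrix (Fin m) (Fin n) ℝ,
    lam * (∑ α, ∑ i, ξ α i ^ 2) ≤ quadForm (a p) ξ ∧
      quadForm (a p) ξ ≤ Lam * (∑ α, ∑ i, ξ α i ^ 2)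

/-- The spatial partial derivative `∂ᵢ f`. -/
noncomputable def spaceDeriv {n : ℕ} (i : Fin n) (f : SpaceTime n → ℝ) (p : SpaceTime n) : ℝ :=
  fderiv ℝ f p (EuclideanSpace.single i 1, 0)

/-- The time derivative `∂ₜ f`. -/
noncomputable def timeDeriv {n : ℕ} (f : SpaceTime n → ℝ) (p : SpaceTime n) : ℝ :=
  fderiv ℝ f p (0, 1)

/-- Smooth real test functions with compact support in `ℝⁿ × (-∞, 0)`. -/
def IsTest {n : ℕ} (ζ : SpaceTime n → ℝ) : Prop :=
  ContDiff ℝ ∞ ζ ∧ HasCompactSupport ζ ∧ tsupport ζ ⊆ past n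

/-- `f ∈ L²_loc(ℝⁿ × (-∞, 0))`. -/
def MemL2Loc {n : ℕ} (f : SpaceTime n → ℝ) : Prop :=
  ∀ K : Set (SpaceTime n), IsCompact K → K ⊆ past n → MemLp f 2 (volume.restrict K)

/-- `G` is the weak spatial gradient of `u` on `ℝⁿ × (-∞, 0)`: `G p α i` is `∂ᵢ u^α`. -/
def IsWeakGradient {m n : ℕ} (u : SpaceTime n → EuclideanSpace ℝ (Fin m))
    (G : SpaceTime n → Matrix (Fin m) (Fin n) ℝ) : Prop :=
  ∀ ζ : SpaceTime n → ℝ, IsTest ζ → ∀ α i,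
    ∫ p, u p α * spaceDeriv i ζ p = -∫ p, G p α i * ζ p

/-- `u` is a weak solution of `u_t = div (a Du)` on `ℝⁿ × (-∞, 0)`: `u` and `Du` are in `L²_loc` and
`u^α_t = ∂ᵢ (a^{ij}_{αβ} ∂ⱼ u^β)` holds in the sense of distributions for every `α`. -/
def IsWeakSolution {m n : ℕ} (a : SpaceTime n → Coeff m n)
    (u : SpaceTime n → EuclideanSpace ℝ (Fin m)) : Prop :=
  (∀ α, MemL2Loc (fun p => u p α)) ∧
    ∃ G : SpaceTime n → Matrix (Fin m) (Fin n) ℝ,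
      (∀ α i, MemL2Loc (fun p => G p α i)) ∧ IsWeakGradient u G ∧
        ∀ ζ : SpaceTime n → ℝ, IsTest ζ → ∀ α,
          ∫ p, u p α * timeDeriv ζ p =
            ∫ p, ∑ β, ∑ i, ∑ j, a p α β i j * G p β j * spaceDeriv i ζ p

end ParabolicSystem

/-!
The solution has the form `u = w x`, where `w` is a function of the parabolic gauge `|x|² - t` and
of the ratio `s = -t / (|x|² - t)`, both radial in `x`. The time derivative of such a field is a
gradient, `u_t = ∇π`, and for `w = (|x|² - t)^{-(1+ε)/2} (1 + 2 s)` the pressure `π` is again a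
power of the gauge times an affine function of `s`. Since `∇π` is the divergence of `π I`, it
suffices to find coefficients `a` with `a Du = π I`.

Let `P` be the spatial gradient of `u` stripped of its power of the gauge. The symmetric tensor
`k I ⊗ I + |P|² Id - P ⊗ P` maps `P` to `k (tr P) I`, which is the required multiple of `I` for a
suitable `k`. Its quadratic form `k (tr ξ)² + |P|² |ξ|² - ⟨P, ξ⟩²` is positive for `k > 0` and
`tr P ≠ 0`: if the Cauchy–Schwarz difference vanishes, then `ξ` is a multiple of `P` and has nonzero
trace.

All these objects are homogeneous under the parabolic dilations `(x, t) ↦ (l x, l² t)`, and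
`|x|² - t = 1` cuts the closed past in a compact set meeting every orbit off the origin.
Ellipticity, boundedness, the Lipschitz estimate and the blow-up rate therefore follow by
compactness, and a nonconstant invariant function has no limit at the origin.
-/

namespace ParabolicSystem

/-! ### Coefficient tensors -/

section PositiveTensor

variable {m n : ℕ}

/-- The matrix `ξ` as a vector of the Euclidean space of dimension `m n`, whose norm is the one in
`UniformlyElliptic`. -/
noncomputable def flatten (ξ : Matrix (Fin m) (Fin n) ℝ) : EuclideanSpace ℝ (Fin m × Fin n) :=
  WithLp.toLp 2 fun q => ξ q.1 q.2

theorem inner_flatten (ξ η : Matrix (Fin m) (Fin n) ℝ) :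
    inner ℝ (flatten ξ) (flatten η) = ∑ α, ∑ i, ξ α i * η α i := by
  simp [flatten, PiLp.inner_apply, Fintype.sum_prod_type, mul_comm]

theorem norm_flatten_sq (ξ : Matrix (Fin m) (Fin n) ℝ) :
    ‖flatten ξ‖ ^ 2 = ∑ α, ∑ i, ξ α i ^ 2 := by
  rw [← real_inner_self_eq_norm_sq, inner_flatten]
  simp only [sq]

theorem flatten_ne_zero {ξ : Matrix (Fin m) (Fin n) ℝ} (hξ : ξ ≠ 0) : flatten ξ ≠ 0 :=
  fun h => hξ (by ext α i; exact congrFun (congrArg WithLp.ofLp h) (α, i))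

theorem quadForm_smul (b : Coeff m n) (r : ℝ) (ξ : Matrix (Fin m) (Fin n) ℝ) :
    quadForm b (r • ξ) = r ^ 2 * quadForm b ξ := by
  simp only [quadForm, Finset.mul_sum, Matrix.smul_apply, smul_eq_mul]
  congr! 4
  ring

theorem uniformlyElliptic_of_isCompact_image {X : Type*} {a : X → Coeff m n} {S : Set X}
    (hS : IsCompact (a '' S))
    (hpos : ∀ p ∈ S, ∀ ξ : Matrix (Fin m) (Fin n) ℝ, ξ ≠ 0 → 0 < quadForm (a p) ξ) :
    UniformlyElliptic a S := by
  let toMatrix (v : EuclideanSpace ℝ (Fin m × Fin n)) : Matrix (Fin m) (Fin n) ℝ :=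
    fun α i => v (α, i)
  let Q (q : Coeff m n × EuclideanSpace ℝ (Fin m × Fin n)) : ℝ := quadForm q.1 (toMatrix q.2)
  have hK : IsCompact ((a '' S) ×ˢ Metric.sphere (0 : EuclideanSpace ℝ (Fin m × Fin n)) 1) :=
    hS.prod (isCompact_sphere 0 1)
  have hQ : Continuous Q := by
    simp only [Q, quadForm, toMatrix]
    fun_prop
  have hQpos : ∀ q ∈ (a '' S) ×ˢ Metric.sphere (0 : EuclideanSpace ℝ (Fin m × Fin n)) 1,
      0 < Q q := by
    rintro ⟨_, v⟩ ⟨⟨p, hp, rfl⟩, hv⟩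
    refine hpos p hp _ fun h => Metric.ne_of_mem_sphere hv one_ne_zero ?_
    ext ⟨α, i⟩
    exact congrFun (congrFun h α) i
  obtain ⟨lam, hlam, hle⟩ := hK.exists_forall_le' hQ.continuousOn hQpos
  obtain ⟨Lam, hge⟩ := hK.exists_bound_of_continuousOn hQ.continuousOn
  refine ⟨lam, max Lam 1, hlam, by positivity, fun p hp ξ => ?_⟩
  rcases eq_or_ne ξ 0 with rfl | hξ
  · simp [quadForm]
  have hv0 : ‖flatten ξ‖ ≠ 0 := norm_ne_zero_iff.2 (flatten_ne_zero hξ)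
  have hmem : (a p, ‖flatten ξ‖⁻¹ • flatten ξ) ∈
      (a '' S) ×ˢ Metric.sphere (0 : EuclideanSpace ℝ (Fin m × Fin n)) 1 :=
    ⟨mem_image_of_mem a hp, by simp [norm_smul, inv_mul_cancel₀ hv0]⟩
  have hscale : quadForm (a p) ξ
      = Q (a p, ‖flatten ξ‖⁻¹ • flatten ξ) * (∑ α, ∑ i, ξ α i ^ 2) := by
    have hξv : ξ = ‖flatten ξ‖ • toMatrix (‖flatten ξ‖⁻¹ • flatten ξ) := by
      ext α i
      exact (mul_inv_cancel_left₀ hv0 (ξ α i)).symm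
    conv_lhs => rw [hξv, quadForm_smul, mul_comm, norm_flatten_sq]
  rw [hscale]
  constructor <;> gcongr
  · exact hle _ hmem
  · exact (le_abs_self _).trans ((hge _ hmem).trans (le_max_left _ _))

end PositiveTensor

theorem mul_inner_sq_add_sub_inner_sq_pos {V : Type*} [NormedAddCommGroup V]
    [InnerProductSpace ℝ V] {k : ℝ} (hk : 0 < k) {e p x : V}
    (hep : inner ℝ e p ≠ 0) (hx : x ≠ 0) :
    0 < k * inner ℝ e x ^ 2 + (‖p‖ ^ 2 * ‖x‖ ^ 2 - inner ℝ p x ^ 2) := by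
  have hp : p ≠ 0 := by
    rintro rfl
    exact hep (inner_zero_right e)
  have hcs : inner ℝ p x ^ 2 ≤ ‖p‖ ^ 2 * ‖x‖ ^ 2 := by
    rw [← mul_pow, ← sq_abs]
    gcongr
    exact abs_real_inner_le_norm p x
  rcases hcs.lt_or_eq with hlt | heq
  · have := mul_nonneg hk.le (sq_nonneg (inner ℝ e x))
    linarith
  · obtain ⟨r, hr, rfl⟩ : ∃ r : ℝ, r ≠ 0 ∧ x = r • p := by
      rw [← norm_inner_eq_norm_iff hp hx, ← sq_eq_sq₀ (by positivity) (by positivity), mul_pow,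
        Real.norm_eq_abs, sq_abs, heq]
    have : inner ℝ e (r • p) ≠ 0 := by
      rw [inner_smul_right]
      exact mul_ne_zero hr hep
    rw [heq, sub_self, add_zero]
    positivity

section PressureTensor

variable {n : ℕ}

/-- The symmetric tensor `k I ⊗ I + |P|² Id - P ⊗ P`, built so that contracting it with `P` gives
the multiple `k (tr P) I` of the identity. -/
def pressureTensor (k : ℝ) (P : Matrix (Fin n) (Fin n) ℝ) : Coeff n n := fun α β i j =>
  k * ((1 : Matrix (Fin n) (Fin n) ℝ) α i * (1 : Matrix (Fin n) (Fin n) ℝ) β j)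
    + (∑ γ, ∑ l, P γ l ^ 2)
      * ((1 : Matrix (Fin n) (Fin n) ℝ) α β * (1 : Matrix (Fin n) (Fin n) ℝ) i j)
    - P α i * P β j

theorem isSymmCoeff_pressureTensor (k : ℝ) (P : Matrix (Fin n) (Fin n) ℝ) :
    IsSymmCoeff (pressureTensor k P) := by
  intro α β i j
  simp only [pressureTensor, Matrix.one_apply, eq_comm (a := β) (b := α),
    eq_comm (a := j) (b := i)]
  ring

theorem contDiffOn_pressureTensor {E : Type*} [NormedAddCommGroup E] [NormedSpace ℝ E]
    {N : WithTop ℕ∞} {S : Set E} {k : E → ℝ} {P : E → Matrix (Fin n) (Fin n) ℝ}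
    (hk : ContDiffOn ℝ N k S) (hP : ∀ α i, ContDiffOn ℝ N (fun p => P p α i) S) :
    ContDiffOn ℝ N (fun p => pressureTensor (k p) (P p)) S := by
  simp only [contDiffOn_pi, pressureTensor]
  fun_prop

theorem sum_pressureTensor_mul (k : ℝ) (P ξ : Matrix (Fin n) (Fin n) ℝ) (α i : Fin n) :
    ∑ β, ∑ j, pressureTensor k P α β i j * ξ β j
      = k * ξ.trace * (1 : Matrix (Fin n) (Fin n) ℝ) α i + (∑ γ, ∑ l, P γ l ^ 2) * ξ α i
        - P α i * ∑ β, ∑ j, P β j * ξ β j := by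
  simp only [pressureTensor, sub_mul, add_mul, Finset.sum_sub_distrib, Finset.sum_add_distrib]
  congr 2
  · simp [Matrix.one_apply, Matrix.trace, Finset.mul_sum]
  · simp [Matrix.one_apply]
  · simp only [Finset.mul_sum, mul_assoc]

theorem sum_pressureTensor_mul_self (k : ℝ) (P : Matrix (Fin n) (Fin n) ℝ) (α i : Fin n) :
    ∑ β, ∑ j, pressureTensor k P α β i j * P β j
      = k * P.trace * (1 : Matrix (Fin n) (Fin n) ℝ) α i := by
  simp only [sum_pressureTensor_mul, ← sq]
  ring

theorem quadForm_pressureTensor (k : ℝ) (P ξ : Matrix (Fin n) (Fin n) ℝ) :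
    quadForm (pressureTensor k P) ξ = k * ξ.trace ^ 2
      + ((∑ γ, ∑ l, P γ l ^ 2) * (∑ γ, ∑ l, ξ γ l ^ 2) - (∑ γ, ∑ l, P γ l * ξ γ l) ^ 2) := by
  have hsum : quadForm (pressureTensor k P) ξ
      = ∑ α, ∑ i, ξ α i * ∑ β, ∑ j, pressureTensor k P α β i j * ξ β j := by
    simp only [quadForm, Finset.mul_sum]
    refine Finset.sum_congr rfl fun α _ => ?_
    rw [Finset.sum_comm]
    congr! 3
    ring
  have hsplit : ∀ α i, ξ α i * (k * ξ.trace * (1 : Matrix (Fin n) (Fin n) ℝ) α i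
      + (∑ γ, ∑ l, P γ l ^ 2) * ξ α i - P α i * ∑ β, ∑ j, P β j * ξ β j)
      = k * ξ.trace * (ξ α i * (1 : Matrix (Fin n) (Fin n) ℝ) α i)
        + (∑ γ, ∑ l, P γ l ^ 2) * ξ α i ^ 2 - (P α i * ξ α i) * ∑ β, ∑ j, P β j * ξ β j := by
    intro α i
    ring
  simp only [hsum, sum_pressureTensor_mul, hsplit, Finset.sum_sub_distrib, Finset.sum_add_distrib,
    ← Finset.mul_sum, ← Finset.sum_mul]
  have htrace : ∑ α, ∑ i, ξ α i * (1 : Matrix (Fin n) (Fin n) ℝ) α i = ξ.trace := by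
    simp [Matrix.one_apply, Matrix.trace]
  rw [htrace]
  ring

theorem quadForm_pressureTensor_pos {k : ℝ} (hk : 0 < k) {P ξ : Matrix (Fin n) (Fin n) ℝ}
    (hP : P.trace ≠ 0) (hξ : ξ ≠ 0) : 0 < quadForm (pressureTensor k P) ξ := by
  have htrace (A : Matrix (Fin n) (Fin n) ℝ) : inner ℝ (flatten 1) (flatten A) = A.trace := by
    simp [inner_flatten, Matrix.one_apply, Matrix.trace]
  rw [quadForm_pressureTensor, ← htrace, ← inner_flatten, ← norm_flatten_sq, ← norm_flatten_sq]
  exact mul_inner_sq_add_sub_inner_sq_pos hk (by rwa [htrace]) (flatten_ne_zero hξ)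

end PressureTensor

/-! ### Parabolic homogeneity -/

section General

theorem exists_lipschitzOnWith_of_norm_fderiv_le {E F : Type*} [NormedAddCommGroup E]
    [NormedSpace ℝ E] [NormedAddCommGroup F] [NormedSpace ℝ F] {s : Set E} (hs : Convex ℝ s)
    {f : E → F} {ρ δ L M : ℝ} (hρ : ρ < δ) (hf : ∀ p ∈ s, ρ ≤ ‖p‖ → DifferentiableAt ℝ f p)
    (hL : ∀ p ∈ s, ρ ≤ ‖p‖ → ‖fderiv ℝ f p‖ ≤ L) (hM : ∀ p ∈ s, ρ ≤ ‖p‖ → ‖f p‖ ≤ M) :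
    ∃ K : NNReal, LipschitzOnWith K f {p | p ∈ s ∧ δ ≤ ‖p‖} := by
  refine ⟨(max L (2 * M / (δ - ρ))).toNNReal, LipschitzOnWith.of_dist_le_mul ?_⟩
  rintro p ⟨hp, hpδ⟩ q ⟨hq, hqδ⟩
  suffices h : dist (f p) (f q) ≤ max L (2 * M / (δ - ρ)) * dist p q from
    h.trans (mul_le_mul_of_nonneg_right (Real.le_coe_toNNReal _) dist_nonneg)
  rcases le_total (dist p q) (δ - ρ) with hclose | hfar
  · have hseg : ∀ z ∈ segment ℝ q p, z ∈ s ∧ ρ ≤ ‖z‖ := by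
      intro z hz
      refine ⟨hs.segment_subset hq hp hz, ?_⟩
      have hzp : dist p z ≤ dist p q := by
        rw [dist_comm p, dist_comm p]
        exact (convex_closedBall p (dist q p)).segment_subset (by simp) (by simp) hz
      linarith [norm_sub_norm_le p z, dist_eq_norm p z]
    rw [dist_eq_norm, dist_eq_norm]
    calc ‖f p - f q‖ ≤ L * ‖p - q‖ :=
          (convex_segment q p).norm_image_sub_le_of_norm_fderiv_le
            (fun z hz => hf z (hseg z hz).1 (hseg z hz).2)
            (fun z hz => hL z (hseg z hz).1 (hseg z hz).2)
            (left_mem_segment ℝ q p) (right_mem_segment ℝ q p)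
      _ ≤ max L (2 * M / (δ - ρ)) * ‖p - q‖ := by
          gcongr
          exact le_max_left _ _
  · have hgap : 0 < δ - ρ := sub_pos.2 hρ
    have hfp := hM p hp (hρ.le.trans hpδ)
    have hfq := hM q hq (hρ.le.trans hqδ)
    have hM0 : 0 ≤ M := (norm_nonneg _).trans hfp
    calc dist (f p) (f q) ≤ 2 * M := by
          rw [dist_eq_norm]
          linarith [norm_sub_le (f p) (f q)]
      _ = 2 * M / (δ - ρ) * (δ - ρ) := by rw [div_mul_cancel₀ _ hgap.ne']
      _ ≤ max L (2 * M / (δ - ρ)) * dist p q := by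
          gcongr
          exact le_max_right _ _

theorem enorm_le_eLpNorm_top_of_isOpen {X F : Type*} [TopologicalSpace X] [MeasurableSpace X]
    [OpensMeasurableSpace X] {μ : Measure X} [μ.IsOpenPosMeasure] [NormedAddCommGroup F]
    {s : Set X} (hs : IsOpen s) {f : X → F} (hf : ContinuousOn f s) {x : X} (hx : x ∈ s) :
    ‖f x‖ₑ ≤ eLpNorm f ⊤ (μ.restrict s) := by
  have hae : (fun y => max ‖f y‖ₑ (eLpNorm f ⊤ (μ.restrict s)))
      =ᵐ[μ.restrict s] fun _ => eLpNorm f ⊤ (μ.restrict s) := by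
    filter_upwards [enorm_ae_le_eLpNormEssSup f (μ.restrict s)] with y hy
    exact max_eq_right (by rwa [eLpNorm_exponent_top])
  have heq := Measure.eqOn_open_of_ae_eq hae hs (hf.enorm.sup continuousOn_const)
    continuousOn_const
  exact max_eq_right_iff.1 (heq hx)

end General

section Homogeneity

variable {n : ℕ}

/-- The parabolic dilation `(x, t) ↦ (l x, l² t)`. -/
noncomputable def dilation (n : ℕ) (l : ℝ) : SpaceTime n →L[ℝ] SpaceTime n :=
  (l • ContinuousLinearMap.id ℝ _).prodMap (l ^ 2 • ContinuousLinearMap.id ℝ ℝ)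

@[simp]
theorem dilation_apply (l : ℝ) (p : SpaceTime n) : dilation n l p = (l • p.1, l ^ 2 * p.2) :=
  rfl

theorem dilation_dilation (k l : ℝ) (p : SpaceTime n) :
    dilation n k (dilation n l p) = dilation n (k * l) p := by
  simp [smul_smul, mul_pow, mul_assoc]

theorem dilation_one (p : SpaceTime n) : dilation n 1 p = p := by
  simp

theorem norm_dilation_le (l : ℝ) : ‖dilation n l‖ ≤ max |l| (l ^ 2) := by
  refine ContinuousLinearMap.opNorm_le_bound _ (by positivity) fun p => ?_
  rw [dilation_apply, Prod.norm_def, norm_smul, norm_mul, Real.norm_eq_abs,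
    Real.norm_of_nonneg (sq_nonneg l), Prod.norm_def]
  exact max_le (by gcongr <;> exact le_max_left _ _) (by gcongr <;> exact le_max_right _ _)

/-- The gauge `|x|² - t`. On the closed past it vanishes only at the origin, it is smooth, and it is
homogeneous of degree two under parabolic dilations: it plays the role of `|x|²` in elliptic
problems. -/
noncomputable def parabolicGauge (p : SpaceTime n) : ℝ := ‖p.1‖ ^ 2 - p.2

/-- The region `t < |x|²` below the paraboloid, an open neighbourhood of `closedPast n \ {0}` that
is invariant under parabolic dilations. -/
def subparaboloid (n : ℕ) : Set (SpaceTime n) := {p | 0 < parabolicGauge p}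

theorem mem_subparaboloid {p : SpaceTime n} : p ∈ subparaboloid n ↔ 0 < parabolicGauge p :=
  Iff.rfl

/-- A cross-section of the dilation orbits in `closedPast n \ {0}`. -/
def unitCap (n : ℕ) : Set (SpaceTime n) := {p ∈ closedPast n | parabolicGauge p = 1}

theorem contDiff_parabolicGauge : ContDiff ℝ ∞ (parabolicGauge (n := n)) :=
  (contDiff_fst.norm_sq ℝ).sub contDiff_snd

theorem isOpen_subparaboloid (n : ℕ) : IsOpen (subparaboloid n) :=
  isOpen_lt continuous_const contDiff_parabolicGauge.continuous

theorem past_subset_closedPast (n : ℕ) : past n ⊆ closedPast n := fun p (hp : p.2 < 0) => hp.le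

theorem past_subset_subparaboloid (n : ℕ) : past n ⊆ subparaboloid n := fun p (hp : p.2 < 0) => by
  rw [mem_subparaboloid, parabolicGauge]
  nlinarith [sq_nonneg ‖p.1‖]

theorem past_subset_closedPast_inter_subparaboloid (n : ℕ) :
    past n ⊆ closedPast n ∩ subparaboloid n :=
  subset_inter (past_subset_closedPast n) (past_subset_subparaboloid n)

theorem mem_subparaboloid_of_ne_zero {p : SpaceTime n} (hp : p ∈ closedPast n) (h0 : p ≠ 0) :
    p ∈ subparaboloid n := by
  rcases (show p.2 ≤ 0 from hp).lt_or_eq with ht | ht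
  · exact past_subset_subparaboloid n ht
  · have hx : p.1 ≠ 0 := fun hx => h0 (Prod.ext hx ht)
    rw [mem_subparaboloid, parabolicGauge, ht, sub_zero]
    positivity

theorem min_le_parabolicGauge {p : SpaceTime n} (hp : p ∈ closedPast n) :
    min (‖p‖ ^ 2) ‖p‖ ≤ parabolicGauge p := by
  have ht : p.2 ≤ 0 := hp
  have ht' : ‖p.2‖ = -p.2 := Real.norm_of_nonpos ht
  rw [parabolicGauge]
  rcases max_choice ‖p.1‖ ‖p.2‖ with h | h <;> rw [Prod.norm_def, h]
  · exact (min_le_left _ _).trans (by linarith)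
  · exact (min_le_right _ _).trans (by nlinarith [sq_nonneg ‖p.1‖])

theorem unitCap_subset (n : ℕ) : unitCap n ⊆ closedPast n ∩ subparaboloid n :=
  fun p hp => ⟨hp.1, by rw [mem_subparaboloid, hp.2]; exact one_pos⟩

theorem isCompact_unitCap (n : ℕ) : IsCompact (unitCap n) := by
  refine (isCompact_closedBall (0 : SpaceTime n) 1).of_isClosed_subset ?_ fun p hp => ?_
  · exact (isClosed_le continuous_snd continuous_const).inter
      (isClosed_eq contDiff_parabolicGauge.continuous continuous_const)
  · have hmin := hp.2 ▸ min_le_parabolicGauge hp.1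
    rw [mem_closedBall_zero_iff]
    by_contra! hlt
    exact absurd hmin (not_le.2 (lt_min (by nlinarith) hlt))

theorem parabolicGauge_dilation (l : ℝ) (p : SpaceTime n) :
    parabolicGauge (dilation n l p) = l ^ 2 * parabolicGauge p := by
  simp only [parabolicGauge, dilation_apply, norm_smul, mul_pow, Real.norm_eq_abs, sq_abs]
  ring

theorem dilation_mem_closedPast (l : ℝ) {p : SpaceTime n} (hp : p ∈ closedPast n) :
    dilation n l p ∈ closedPast n :=
  mul_nonpos_of_nonneg_of_nonpos (sq_nonneg l) hp

theorem dilation_mem_subparaboloid {l : ℝ} (hl : 0 < l) {p : SpaceTime n}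
    (hp : p ∈ subparaboloid n) : dilation n l p ∈ subparaboloid n := by
  rw [mem_subparaboloid, parabolicGauge_dilation]
  exact mul_pos (by positivity) hp

theorem exists_unitCap_dilation_eq {p : SpaceTime n} (hp : p ∈ closedPast n ∩ subparaboloid n) :
    ∃ q ∈ unitCap n, dilation n (√(parabolicGauge p)) q = p := by
  have hg : 0 < √(parabolicGauge p) := Real.sqrt_pos.2 hp.2
  refine ⟨dilation n (√(parabolicGauge p))⁻¹ p, ⟨dilation_mem_closedPast _ hp.1, ?_⟩, ?_⟩
  · rw [parabolicGauge_dilation, inv_pow, Real.sq_sqrt (le_of_lt hp.2),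
      inv_mul_cancel₀ (ne_of_gt hp.2)]
  · rw [dilation_dilation, mul_inv_cancel₀ hg.ne', dilation_one]

theorem tendsto_dilation_nhdsGT_zero (p : SpaceTime n) :
    Tendsto (fun l => dilation n l p) (𝓝[>] 0) (𝓝 0) := by
  have hcont : Continuous fun l : ℝ => dilation n l p := by
    simp only [dilation_apply]
    fun_prop
  simpa [← Prod.zero_eq_mk] using (hcont.tendsto 0).mono_left nhdsWithin_le_nhds

theorem convex_closedPast (n : ℕ) : Convex ℝ (closedPast n) :=
  convex_halfSpace_le (LinearMap.snd ℝ _ ℝ).isLinear 0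

variable {F : Type*} [NormedAddCommGroup F] [NormedSpace ℝ F] {d : ℝ} {f : SpaceTime n → F}

/-- Homogeneity of degree `d` under the parabolic dilations `(x, t) ↦ (l x, l² t)`. It is required
off the origin only, where negative degrees make sense, and on an open set, so that it passes to
derivatives. -/
def IsParabolicallyHomogeneous (d : ℝ) (f : SpaceTime n → F) : Prop :=
  ∀ l : ℝ, 0 < l → ∀ p ∈ subparaboloid n, f (dilation n l p) = l ^ d • f p

theorem contDiff_slice {N : WithTop ℕ∞} {t : ℝ} (ht : t < 0) (hf : ContDiffOn ℝ N f (past n)) :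
    ContDiff ℝ N fun x => f (x, t) :=
  hf.comp_contDiff (by fun_prop) fun _ => ht

namespace IsParabolicallyHomogeneous

theorem eq_self_similar (hf : IsParabolicallyHomogeneous d f) (x : EuclideanSpace ℝ (Fin n))
    {t : ℝ} (ht : t < 0) : f (x, t) = (-t) ^ (d / 2) • f ((√(-t))⁻¹ • x, -1) := by
  have ht' : 0 < -t := neg_pos.2 ht
  have hdil : dilation n √(-t) ((√(-t))⁻¹ • x, -1) = (x, t) := by
    simp [smul_smul, mul_inv_cancel₀ (Real.sqrt_pos.2 ht').ne', Real.sq_sqrt ht'.le]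
  conv_lhs => rw [← hdil, hf _ (Real.sqrt_pos.2 ht') _
    (past_subset_subparaboloid n (neg_one_lt_zero : (-1 : ℝ) < 0)),
    ← Real.rpow_div_two_eq_sqrt _ ht'.le]

theorem exists_norm_le (hf : IsParabolicallyHomogeneous d f)
    (hc : ContinuousOn f (closedPast n ∩ subparaboloid n)) :
    ∃ C : ℝ, 0 < C ∧
      ∀ p ∈ closedPast n ∩ subparaboloid n, ‖f p‖ ≤ C * parabolicGauge p ^ (d / 2) := by
  obtain ⟨C, hC⟩ := (isCompact_unitCap n).exists_bound_of_continuousOn (hc.mono (unitCap_subset n))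
  refine ⟨max C 1, by positivity, fun p hp => ?_⟩
  obtain ⟨q, hq, hqp⟩ := exists_unitCap_dilation_eq hp
  have hg : 0 < parabolicGauge p := hp.2
  calc ‖f p‖ = ‖f q‖ * parabolicGauge p ^ (d / 2) := by
        rw [← hqp, hf _ (Real.sqrt_pos.2 hg) q (unitCap_subset n hq).2, hqp, norm_smul,
          Real.norm_of_nonneg (by positivity), ← Real.rpow_div_two_eq_sqrt _ hg.le, mul_comm]
    _ ≤ max C 1 * parabolicGauge p ^ (d / 2) := by
        gcongr
        exact (hC q hq).trans (le_max_left _ _)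

theorem exists_norm_slice_le (hf : IsParabolicallyHomogeneous d f) (hd : d ≤ 0)
    (hc : ContinuousOn f (closedPast n ∩ subparaboloid n)) :
    ∃ C : ℝ, ∀ y : EuclideanSpace ℝ (Fin n), ‖f (y, -1)‖ ≤ C := by
  obtain ⟨C, hC, hle⟩ := hf.exists_norm_le hc
  refine ⟨C, fun y => (hle _ (past_subset_closedPast_inter_subparaboloid n
    (neg_one_lt_zero : (-1 : ℝ) < 0))).trans ?_⟩
  refine mul_le_of_le_one_right hC.le (Real.rpow_le_one_of_one_le_of_nonpos ?_ (by linarith))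
  simp [parabolicGauge]

theorem fderiv_dilation (hf : IsParabolicallyHomogeneous d f) {l : ℝ} (hl : 0 < l)
    {p : SpaceTime n} (hp : p ∈ subparaboloid n) (hd : DifferentiableAt ℝ f p) :
    fderiv ℝ f (dilation n l p) = l ^ d • (fderiv ℝ f p).comp (dilation n l⁻¹) := by
  have hback : ∀ q ∈ subparaboloid n, l ^ d • f (dilation n l⁻¹ q) = f q := by
    intro q hq
    rw [← hf l hl _ (dilation_mem_subparaboloid (inv_pos.2 hl) hq), dilation_dilation,
      mul_inv_cancel₀ hl.ne', dilation_one]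
  have hcancel : dilation n l⁻¹ (dilation n l p) = p := by
    rw [dilation_dilation, inv_mul_cancel₀ hl.ne', dilation_one]
  have hderiv : HasFDerivAt (fun q => l ^ d • f (dilation n l⁻¹ q))
      (l ^ d • (fderiv ℝ f p).comp (dilation n l⁻¹)) (dilation n l p) := by
    refine HasFDerivAt.const_smul ?_ _
    refine HasFDerivAt.comp _ ?_ (dilation n l⁻¹).hasFDerivAt
    rw [hcancel]
    exact hd.hasFDerivAt
  refine (hderiv.congr_of_eventuallyEq ?_).fderiv
  filter_upwards [(isOpen_subparaboloid n).mem_nhds (dilation_mem_subparaboloid hl hp)] with q hq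
  exact (hback q hq).symm

theorem exists_norm_fderiv_le (hf : IsParabolicallyHomogeneous d f) (hd : d ≤ 0)
    (hC1 : ContDiffOn ℝ 1 f (subparaboloid n)) {r : ℝ} (hr : 0 < r) :
    ∃ C : ℝ, ∀ p ∈ closedPast n, r ≤ parabolicGauge p → ‖fderiv ℝ f p‖ ≤ C := by
  obtain ⟨C, hC⟩ := (isCompact_unitCap n).exists_bound_of_continuousOn
    ((hC1.continuousOn_fderiv_of_isOpen (isOpen_subparaboloid n) le_rfl).mono
      ((unitCap_subset n).trans inter_subset_right))
  refine ⟨√r ^ d * (C * max |(√r)⁻¹| ((√r)⁻¹ ^ 2)), fun p hp hrp => ?_⟩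
  obtain ⟨q, hq, hqp⟩ := exists_unitCap_dilation_eq ⟨hp, hr.trans_le hrp⟩
  have hq' : q ∈ subparaboloid n := (unitCap_subset n hq).2
  have hsr : 0 < √r := Real.sqrt_pos.2 hr
  have hle : √r ≤ √(parabolicGauge p) := Real.sqrt_le_sqrt hrp
  have hl : 0 < √(parabolicGauge p) := hsr.trans_le hle
  have hdiff : DifferentiableAt ℝ f q :=
    (hC1.differentiableOn one_ne_zero).differentiableAt ((isOpen_subparaboloid n).mem_nhds hq')
  calc ‖fderiv ℝ f p‖
      = √(parabolicGauge p) ^ d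
          * ‖(fderiv ℝ f q).comp (dilation n (√(parabolicGauge p))⁻¹)‖ := by
        conv_lhs => rw [← hqp, hf.fderiv_dilation hl hq' hdiff]
        rw [norm_smul, Real.norm_of_nonneg (by positivity)]
    _ ≤ √(parabolicGauge p) ^ d
          * (C * max |(√(parabolicGauge p))⁻¹| ((√(parabolicGauge p))⁻¹ ^ 2)) := by
        gcongr
        exact (ContinuousLinearMap.opNorm_comp_le _ _).trans
          (mul_le_mul (hC q hq) (norm_dilation_le _) (norm_nonneg _)
            ((norm_nonneg _).trans (hC q hq)))
    _ ≤ √r ^ d * (C * max |(√r)⁻¹| ((√r)⁻¹ ^ 2)) := by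
        have hC0 : 0 ≤ C := (norm_nonneg _).trans (hC q hq)
        rw [abs_of_pos (inv_pos.2 hl), abs_of_pos (inv_pos.2 hsr)]
        have hpow := Real.rpow_le_rpow_of_nonpos hsr hle hd
        gcongr

theorem exists_lipschitzOnWith (hf : IsParabolicallyHomogeneous d f) (hd : d ≤ 0)
    (hC1 : ContDiffOn ℝ 1 f (subparaboloid n)) {δ : ℝ} (hδ : 0 < δ) :
    ∃ K : NNReal, LipschitzOnWith K f {p | p ∈ closedPast n ∧ δ ≤ ‖p‖} := by
  have hr : 0 < min ((δ / 2) ^ 2) (δ / 2) := by positivity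
  have hgauge : ∀ p ∈ closedPast n, δ / 2 ≤ ‖p‖ →
      min ((δ / 2) ^ 2) (δ / 2) ≤ parabolicGauge p := fun p hp h =>
    (min_le_min (by gcongr) h).trans (min_le_parabolicGauge hp)
  obtain ⟨L, hL⟩ := hf.exists_norm_fderiv_le hd hC1 hr
  obtain ⟨C, hC, hle⟩ := hf.exists_norm_le (hC1.continuousOn.mono inter_subset_right)
  refine exists_lipschitzOnWith_of_norm_fderiv_le (convex_closedPast n) (half_lt_self hδ)
    (fun p hp h => (hC1.differentiableOn one_ne_zero).differentiableAt
      ((isOpen_subparaboloid n).mem_nhds (hr.trans_le (hgauge p hp h))))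
    (fun p hp h => hL p hp (hgauge p hp h))
    (M := C * min ((δ / 2) ^ 2) (δ / 2) ^ (d / 2)) fun p hp h => ?_
  refine (hle p ⟨hp, hr.trans_le (hgauge p hp h)⟩).trans ?_
  gcongr C * ?_
  exact Real.rpow_le_rpow_of_nonpos hr (hgauge p hp h) (by linarith)

theorem isCompact_image_closedPast (hf : IsParabolicallyHomogeneous 0 f)
    (hc : ContinuousOn f (closedPast n ∩ subparaboloid n)) : IsCompact (f '' closedPast n) := by
  have himage : f '' closedPast n = insert (f 0) (f '' unitCap n) := by
    refine Subset.antisymm ?_ (insert_subset (mem_image_of_mem f (le_refl (0 : ℝ))) ?_)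
    · rintro _ ⟨p, hp, rfl⟩
      rcases eq_or_ne p 0 with rfl | h0
      · exact mem_insert _ _
      · have hp' : p ∈ subparaboloid n := mem_subparaboloid_of_ne_zero hp h0
        obtain ⟨q, hq, hqp⟩ := exists_unitCap_dilation_eq ⟨hp, hp'⟩
        refine mem_insert_of_mem _ ⟨q, hq, ?_⟩
        rw [← hqp, hf _ (Real.sqrt_pos.2 hp') q (unitCap_subset n hq).2, Real.rpow_zero, one_smul]
    · exact image_mono ((unitCap_subset n).trans inter_subset_left)
  rw [himage]
  exact ((isCompact_unitCap n).image_of_continuousOn (hc.mono (unitCap_subset n))).insert _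

theorem eq_of_tendsto (hf : IsParabolicallyHomogeneous 0 f) {L : F}
    (hL : Tendsto f (𝓝[past n] 0) (𝓝 L)) {p : SpaceTime n} (hp : p ∈ past n) : f p = L := by
  have hdil : Tendsto (fun l => dilation n l p) (𝓝[>] 0) (𝓝[past n] 0) := by
    refine tendsto_nhdsWithin_iff.2 ⟨tendsto_dilation_nhdsGT_zero p, ?_⟩
    filter_upwards [self_mem_nhdsWithin] with l (hl : 0 < l)
    exact mul_neg_of_pos_of_neg (pow_pos hl 2) hp
  have hconst : f ∘ (fun l => dilation n l p) =ᶠ[𝓝[>] 0] fun _ => f p := by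
    filter_upwards [self_mem_nhdsWithin] with l (hl : 0 < l)
    rw [Function.comp_apply, hf l hl p (past_subset_subparaboloid n hp), Real.rpow_zero, one_smul]
  exact tendsto_nhds_unique (tendsto_const_nhds.congr' hconst.symm) (hL.comp hdil)

theorem smul_initial (hf : IsParabolicallyHomogeneous d f) {x : EuclideanSpace ℝ (Fin n)}
    (hx : x ≠ 0) {s : ℝ} (hs : 0 < s) : f (s • x, 0) = s ^ d • f (x, 0) := by
  simpa using hf s hs (x, 0) (mem_subparaboloid_of_ne_zero (le_refl (0 : ℝ)) (by simpa using hx))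

theorem not_tendsto_initial_of_odd (hf : IsParabolicallyHomogeneous d f) (hd : d ≤ 0)
    (hodd : ∀ x, f (-x, 0) = -f (x, 0)) {x : EuclideanSpace ℝ (Fin n)} (hx : x ≠ 0)
    (hfx : f (x, 0) ≠ 0) : ¬ ∃ L, Tendsto (fun y => f (y, (0 : ℝ))) (𝓝[≠] 0) (𝓝 L) := by
  rintro ⟨L, hL⟩
  have hray : ∀ y : EuclideanSpace ℝ (Fin n), y ≠ 0 →
      Tendsto (fun l : ℝ => f (l • y, (0 : ℝ))) (𝓝[>] 0) (𝓝 L) := by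
    intro y hy
    refine hL.comp (tendsto_nhdsWithin_iff.2 ⟨?_, ?_⟩)
    · have hcont : Continuous fun l : ℝ => l • y := by fun_prop
      simpa using (hcont.tendsto 0).mono_left nhdsWithin_le_nhds
    · filter_upwards [self_mem_nhdsWithin] with l (hl : 0 < l)
      exact smul_ne_zero hl.ne' hy
  have hneg : Tendsto (fun l : ℝ => f (l • x, (0 : ℝ))) (𝓝[>] 0) (𝓝 (-L)) := by
    simpa [hodd] using (hray (-x) (neg_ne_zero.2 hx)).neg
  have := IsAddTorsionFree.of_isTorsionFree ℝ F
  have hL0 : L = 0 := self_eq_neg.1 (tendsto_nhds_unique (hray x hx) hneg)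
  have hlower : ‖f (x, 0)‖ ≤ ‖L‖ := by
    refine ge_of_tendsto (hray x hx).norm ?_
    filter_upwards [Ioc_mem_nhdsGT one_pos] with l hl
    rw [hf.smul_initial hx hl.1, norm_smul, Real.norm_of_nonneg (Real.rpow_nonneg hl.1.le d)]
    exact le_mul_of_one_le_left (norm_nonneg _)
      (Real.one_le_rpow_of_pos_of_le_one_of_nonpos hl.1 hl.2 hd)
  rw [hL0, norm_zero, norm_le_zero_iff] at hlower
  exact hfx hlower

theorem exists_eLpNorm_ball_bounds (hf : IsParabolicallyHomogeneous d f) (hd : d ≤ 0)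
    (hc : ContinuousOn f (closedPast n ∩ subparaboloid n)) {y : EuclideanSpace ℝ (Fin n)}
    (hy : y ∈ Metric.ball 0 1) (hfy : f (y, -1) ≠ 0) :
    ∃ c C : ℝ, 0 < c ∧ 0 < C ∧ ∀ t ∈ Ico (-1 : ℝ) 0,
      ENNReal.ofReal (c * (-t) ^ (d / 2)) ≤
          eLpNorm (fun x => f (x, t)) ⊤ (volume.restrict (Metric.ball 0 1)) ∧
        eLpNorm (fun x => f (x, t)) ⊤ (volume.restrict (Metric.ball 0 1)) ≤
          ENNReal.ofReal (C * (-t) ^ (d / 2)) := by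
  obtain ⟨C, hC, hle⟩ := hf.exists_norm_le hc
  refine ⟨‖f (y, -1)‖, C, norm_pos_iff.2 hfy, hC, fun t ⟨ht1, ht⟩ => ?_⟩
  have ht' : 0 < -t := neg_pos.2 ht
  have hpast : ∀ x : EuclideanSpace ℝ (Fin n), (x, t) ∈ closedPast n ∩ subparaboloid n :=
    fun _ => past_subset_closedPast_inter_subparaboloid n ht
  constructor
  · have hmem : √(-t) • y ∈ Metric.ball (0 : EuclideanSpace ℝ (Fin n)) 1 := by
      rw [mem_ball_zero_iff, norm_smul, Real.norm_of_nonneg (Real.sqrt_nonneg _)]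
      rw [mem_ball_zero_iff] at hy
      exact mul_lt_one_of_nonneg_of_lt_one_right (Real.sqrt_le_one.2 (by linarith))
        (norm_nonneg y) hy
    have hcont : Continuous fun x => f (x, t) :=
      hc.comp_continuous (by fun_prop) hpast
    refine le_trans (le_of_eq ?_)
      (enorm_le_eLpNorm_top_of_isOpen Metric.isOpen_ball hcont.continuousOn hmem)
    rw [hf.eq_self_similar _ ht, inv_smul_smul₀ (Real.sqrt_pos.2 ht').ne', ← ofReal_norm,
      norm_smul, Real.norm_of_nonneg (by positivity), mul_comm]
  · rw [eLpNorm_exponent_top]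
    refine eLpNormEssSup_le_of_ae_bound (ae_of_all _ fun x => (hle _ (hpast x)).trans ?_)
    gcongr C * ?_
    exact Real.rpow_le_rpow_of_nonpos ht' (by simp [parabolicGauge]) (by linarith)

end IsParabolicallyHomogeneous

end Homogeneity

/-! ### Classical solutions are weak solutions -/

section WeakSolution

variable {n : ℕ} {f ζ : SpaceTime n → ℝ}

theorem isOpen_past (n : ℕ) : IsOpen (past n) :=
  isOpen_lt continuous_snd continuous_const

theorem memL2Loc_of_continuousOn (hf : ContinuousOn f (past n)) : MemL2Loc f := by
  intro K hK hKp
  obtain ⟨C, hC⟩ := hK.exists_bound_of_continuousOn (hf.mono hKp)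
  have : IsFiniteMeasure (volume.restrict K) := ⟨by simpa using hK.measure_lt_top⟩
  exact MemLp.of_bound ((hf.mono hKp).aestronglyMeasurable hK.measurableSet) C
    (ae_restrict_of_forall_mem hK.measurableSet hC)

namespace IsTest

theorem fderiv_apply (hζ : IsTest ζ) (v : SpaceTime n) : IsTest fun p => fderiv ℝ ζ p v :=
  ⟨(hζ.1.fderiv_right (by simp)).clm_apply contDiff_const, hζ.2.1.fderiv_apply ℝ v,
    (tsupport_fderiv_apply_subset ℝ v).trans hζ.2.2⟩

theorem eq_zero_of_notMem_past (hζ : IsTest ζ) {p : SpaceTime n} (hp : p ∉ past n) : ζ p = 0 :=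
  image_eq_zero_of_notMem_tsupport fun h => hp (hζ.2.2 h)

theorem integrable_mul (hζ : IsTest ζ) (hf : ContinuousOn f (past n)) :
    Integrable fun p => f p * ζ p := by
  have hsupp : Function.support (fun p => f p * ζ p) ⊆ tsupport ζ :=
    (Function.support_mul_subset_right f ζ).trans subset_closure
  rw [← integrableOn_iff_integrable_of_support_subset hsupp]
  exact ((hf.mono hζ.2.2).mul hζ.1.continuous.continuousOn).integrableOn_compact hζ.2.1

theorem integral_mul_fderiv (hζ : IsTest ζ) (hf : ContDiffOn ℝ 1 f (past n)) (v : SpaceTime n) :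
    ∫ p, f p * fderiv ℝ ζ p v = -∫ p, fderiv ℝ f p v * ζ p := by
  have : (volume : Measure (SpaceTime n)).IsAddHaarMeasure :=
    Measure.prod.instIsAddHaarMeasure volume volume
  refine integral_mul_fderiv_eq_neg_fderiv_mul_of_integrable ?_ ?_ ?_ ?_ ?_
  · exact hζ.integrable_mul
      ((hf.continuousOn_fderiv_of_isOpen (isOpen_past n) le_rfl).clm_apply continuousOn_const)
  · exact (hζ.fderiv_apply v).integrable_mul hf.continuousOn
  · exact hζ.integrable_mul hf.continuousOn
  · exact fun p hp => (hf.differentiableOn one_ne_zero).differentiableAt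
      ((isOpen_past n).mem_nhds (hζ.2.2 hp))
  · exact fun p _ => (hζ.1.differentiable (by simp)).differentiableAt

end IsTest

theorem isWeakSolution_of_classical {m : ℕ} {a : SpaceTime n → Coeff m n}
    {u : SpaceTime n → EuclideanSpace ℝ (Fin m)} {σ : SpaceTime n → Matrix (Fin m) (Fin n) ℝ}
    (hu : ∀ α, ContDiffOn ℝ 1 (fun p => u p α) (past n))
    (hσ : ∀ α i, ContDiffOn ℝ 1 (fun p => σ p α i) (past n))
    (hflux : ∀ p ∈ past n, ∀ α i,
      ∑ β, ∑ j, a p α β i j * spaceDeriv j (fun q => u q β) p = σ p α i)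
    (heq : ∀ p ∈ past n, ∀ α,
      timeDeriv (fun q => u q α) p = ∑ i, spaceDeriv i (fun q => σ q α i) p) :
    IsWeakSolution a u := by
  refine ⟨fun α => memL2Loc_of_continuousOn (hu α).continuousOn,
    fun p α i => spaceDeriv i (fun q => u q α) p, fun α i => memL2Loc_of_continuousOn ?_,
    fun ζ hζ α i => hζ.integral_mul_fderiv (hu α) _, fun ζ hζ α => ?_⟩
  · exact ((hu α).continuousOn_fderiv_of_isOpen (isOpen_past n) le_rfl).clm_apply
      continuousOn_const
  have hdiv : ∀ p, timeDeriv (fun q => u q α) p * ζ p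
      = ∑ i, spaceDeriv i (fun q => σ q α i) p * ζ p := by
    intro p
    by_cases hp : p ∈ past n
    · rw [heq p hp, Finset.sum_mul]
    · simp [hζ.eq_zero_of_notMem_past hp]
  have hweak : ∀ p, ∑ i, σ p α i * spaceDeriv i ζ p
      = ∑ β, ∑ i, ∑ j, a p α β i j * spaceDeriv j (fun q => u q β) p * spaceDeriv i ζ p := by
    intro p
    by_cases hp : p ∈ past n
    · rw [Finset.sum_comm]
      simp only [← hflux p hp, Finset.sum_mul]
    · simp [spaceDeriv, (hζ.fderiv_apply _).eq_zero_of_notMem_past hp]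
  calc ∫ p, u p α * timeDeriv ζ p
      = -∫ p, ∑ i, spaceDeriv i (fun q => σ q α i) p * ζ p := by
        simp only [← hdiv]
        exact hζ.integral_mul_fderiv (hu α) _
    _ = ∑ i, ∫ p, σ p α i * spaceDeriv i ζ p := by
        rw [integral_finsetSum, ← Finset.sum_neg_distrib]
        · exact Finset.sum_congr rfl fun i _ => (hζ.integral_mul_fderiv (hσ α i) _).symm
        · exact fun i _ => hζ.integrable_mul (((hσ α i).continuousOn_fderiv_of_isOpen
            (isOpen_past n) le_rfl).clm_apply continuousOn_const)
    _ = ∫ p, ∑ i, σ p α i * spaceDeriv i ζ p :=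
        (integral_finsetSum _ fun i _ =>
          (hζ.fderiv_apply _).integrable_mul (hσ α i).continuousOn).symm
    _ = _ := by simp only [hweak]

end WeakSolution

/-! ### The explicit solution -/

section ExplicitSolution

variable {n : ℕ} {ε : ℝ} {p : SpaceTime n}

/-- The ratio `s = -t / (|x|² - t)`. It is invariant under parabolic dilations and runs from `0` at
`t = 0` to `1` at `x = 0`. -/
noncomputable def relTime (p : SpaceTime n) : ℝ := -p.2 / parabolicGauge p

/-- The weight `(|x|² - t)^{-(1+ε)/2} (b + c s)`, where `s` is `relTime`; the solution and its
pressure are built from weights. -/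
noncomputable def weight (ε b c : ℝ) (p : SpaceTime n) : ℝ :=
  parabolicGauge p ^ (-((1 + ε) / 2)) * (b + c * relTime p)

/-- The solution `u = (|x|² - t)^{-(1+ε)/2} (1 + 2 s) x`. -/
noncomputable def solution (ε : ℝ) (p : SpaceTime n) : EuclideanSpace ℝ (Fin n) :=
  weight ε 1 2 p • p.1

/-- The dilation-invariant matrix `P` with `Du = (|x|² - t)^{-(1+ε)/2} P`. -/
noncomputable def gradShape (ε : ℝ) (p : SpaceTime n) : Matrix (Fin n) (Fin n) ℝ :=
  (1 + 2 * relTime p) • (1 : Matrix (Fin n) (Fin n) ℝ)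
    - ((1 + ε + 2 * (3 + ε) * relTime p) / parabolicGauge p) • Matrix.vecMulVec p.1.ofLp p.1.ofLp

/-- The constant `b` for which the weight `π = (|x|² - t)^{-(1+ε)/2} (b - s)` satisfies
`u_t = ∇π`. -/
noncomputable def pressureConst (ε : ℝ) : ℝ := (3 - ε) / (2 * (1 + ε))

/-- The pressure `π`, a potential of `u_t`. -/
noncomputable def pressure (ε : ℝ) : SpaceTime n → ℝ := weight ε (pressureConst ε) (-1)

/-- The coefficients, chosen so that the flux `a Du` is the multiple `π I` of the identity, whose
divergence is `∇π`. -/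
noncomputable def coefficients (ε : ℝ) (p : SpaceTime n) : Coeff n n :=
  pressureTensor ((pressureConst ε - relTime p) / (gradShape ε p).trace) (gradShape ε p)

theorem relTime_nonneg (hp : p ∈ closedPast n) : 0 ≤ relTime p :=
  div_nonneg (neg_nonneg.2 hp) (sub_nonneg.2 (le_trans hp (sq_nonneg _)))

theorem norm_sq_div_parabolicGauge_le (p : SpaceTime n) :
    ‖p.1‖ ^ 2 / parabolicGauge p ≤ 1 - relTime p := by
  rw [relTime, le_sub_iff_add_le, ← add_div, ← sub_eq_add_neg]
  exact div_self_le_one _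

theorem relTime_le_one (hp : p ∈ closedPast n) : relTime p ≤ 1 := by
  have hnonneg : 0 ≤ ‖p.1‖ ^ 2 / parabolicGauge p :=
    div_nonneg (sq_nonneg _) (sub_nonneg.2 (le_trans hp (sq_nonneg _)))
  linarith [norm_sq_div_parabolicGauge_le p]

theorem relTime_dilation {l : ℝ} (hl : 0 < l) (p : SpaceTime n) :
    relTime (dilation n l p) = relTime p := by
  rw [relTime, parabolicGauge_dilation, dilation_apply, ← mul_neg,
    mul_div_mul_left _ _ (pow_ne_zero 2 hl.ne'), relTime]

theorem gradShape_dilation {l : ℝ} (hl : 0 < l) (p : SpaceTime n) :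
    gradShape ε (dilation n l p) = gradShape ε p := by
  rw [gradShape, relTime_dilation hl, parabolicGauge_dilation, gradShape]
  congr 1
  ext α i
  simp only [dilation_apply, WithLp.ofLp_smul, Matrix.vecMulVec_apply, Matrix.smul_apply,
    Pi.smul_apply, smul_eq_mul]
  field_simp

theorem isParabolicallyHomogeneous_weight (ε b c : ℝ) :
    IsParabolicallyHomogeneous (-(1 + ε)) (weight (n := n) ε b c) := by
  intro l hl p hp
  have hpow : (l ^ 2) ^ (-((1 + ε) / 2)) = l ^ (-(1 + ε)) := by
    rw [← Real.rpow_natCast, ← Real.rpow_mul hl.le]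
    congr 1
    push_cast
    ring
  rw [weight, parabolicGauge_dilation, relTime_dilation hl,
    Real.mul_rpow (sq_nonneg l) (le_of_lt hp), hpow, weight, smul_eq_mul, mul_assoc]

theorem isParabolicallyHomogeneous_solution (ε : ℝ) :
    IsParabolicallyHomogeneous (-ε) (solution (n := n) ε) := by
  intro l hl p hp
  rw [solution, isParabolicallyHomogeneous_weight ε 1 2 l hl p hp, dilation_apply, solution,
    smul_smul, smul_smul, smul_eq_mul, mul_right_comm, ← Real.rpow_add_one hl.ne']
  congr 3
  ring

theorem isParabolicallyHomogeneous_coefficients (ε : ℝ) :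
    IsParabolicallyHomogeneous 0 (coefficients (n := n) ε) := by
  intro l hl p _
  simp only [coefficients, relTime_dilation hl, gradShape_dilation hl, Real.rpow_zero, one_smul]

theorem contDiffOn_relTime : ContDiffOn ℝ ∞ relTime (subparaboloid n) :=
  contDiff_snd.neg.contDiffOn.div contDiff_parabolicGauge.contDiffOn fun _ hp => ne_of_gt hp

theorem contDiffOn_weight (ε b c : ℝ) : ContDiffOn ℝ ∞ (weight ε b c) (subparaboloid n) :=
  (contDiff_parabolicGauge.contDiffOn.rpow_const_of_ne fun _ hp => ne_of_gt hp).mul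
    (contDiffOn_const.add (contDiffOn_const.mul contDiffOn_relTime))

theorem contDiffOn_solution (ε : ℝ) : ContDiffOn ℝ ∞ (solution ε) (subparaboloid n) :=
  (contDiffOn_weight ε 1 2).smul contDiffOn_fst

theorem contDiffOn_gradShape (ε : ℝ) (α i : Fin n) :
    ContDiffOn ℝ ∞ (fun p => gradShape ε p α i) (subparaboloid n) := by
  have hcoord (k : Fin n) : ContDiffOn ℝ ∞ (fun p : SpaceTime n => p.1 k) (subparaboloid n) := by
    fun_prop
  refine ((contDiffOn_const.add (contDiffOn_const.mul contDiffOn_relTime)).mul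
    contDiffOn_const).sub (ContDiffOn.mul ?_ ((hcoord α).mul (hcoord i)))
  exact (contDiffOn_const.add (contDiffOn_const.mul contDiffOn_relTime)).div
    contDiff_parabolicGauge.contDiffOn fun _ hp => ne_of_gt hp

theorem differentiableAt_coord (i : Fin n) (p : SpaceTime n) :
    DifferentiableAt ℝ (fun q : SpaceTime n => q.1 i) p := by
  fun_prop

theorem fderiv_coord_apply (i : Fin n) (p v : SpaceTime n) :
    fderiv ℝ (fun q : SpaceTime n => q.1 i) p v = v.1 i := by
  have hcoord : HasFDerivAt (fun q : SpaceTime n => q.1 i) _ p :=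
    (EuclideanSpace.proj (𝕜 := ℝ) i).hasFDerivAt.comp p hasFDerivAt_fst
  rw [hcoord.fderiv]
  rfl

theorem spaceDeriv_mul_coord {w : SpaceTime n → ℝ} (hw : DifferentiableAt ℝ w p) (α i : Fin n) :
    spaceDeriv i (fun q => w q * q.1 α) p
      = w p * (1 : Matrix (Fin n) (Fin n) ℝ) α i + spaceDeriv i w p * p.1 α := by
  rw [spaceDeriv, fderiv_fun_mul hw (differentiableAt_coord α p)]
  simp [fderiv_coord_apply, spaceDeriv, Matrix.one_apply, PiLp.single_apply, mul_comm]

theorem timeDeriv_mul_coord {w : SpaceTime n → ℝ} (hw : DifferentiableAt ℝ w p) (α : Fin n) :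
    timeDeriv (fun q => w q * q.1 α) p = timeDeriv w p * p.1 α := by
  rw [timeDeriv, fderiv_fun_mul hw (differentiableAt_coord α p)]
  simp [fderiv_coord_apply, timeDeriv, mul_comm]

/-- The differential of `parabolicGauge`. -/
noncomputable def gaugeDeriv (p : SpaceTime n) : SpaceTime n →L[ℝ] ℝ :=
  (2 • innerSL ℝ p.1).comp (ContinuousLinearMap.fst ℝ _ ℝ) - ContinuousLinearMap.snd ℝ _ ℝ

theorem gaugeDeriv_apply (p v : SpaceTime n) : gaugeDeriv p v = 2 * inner ℝ p.1 v.1 - v.2 := by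
  simp [gaugeDeriv]

theorem hasFDerivAt_parabolicGauge (p : SpaceTime n) :
    HasFDerivAt parabolicGauge (gaugeDeriv p) p :=
  hasFDerivAt_fst.norm_sq.sub hasFDerivAt_snd

theorem hasFDerivAt_relTime (hp : p ∈ subparaboloid n) :
    HasFDerivAt relTime
      (-(parabolicGauge p)⁻¹ • (ContinuousLinearMap.snd ℝ _ ℝ + relTime p • gaugeDeriv p)) p := by
  have hg : parabolicGauge p ≠ 0 := ne_of_gt hp
  have hquot := hasFDerivAt_snd.neg.mul
    ((hasDerivAt_inv hg).comp_hasFDerivAt p (hasFDerivAt_parabolicGauge p))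
  refine hquot.congr_fderiv (ContinuousLinearMap.ext fun v => ?_)
  simp only [Pi.neg_apply, Function.comp_apply, add_apply, smul_apply, neg_apply,
    ContinuousLinearMap.coe_snd', smul_eq_mul, relTime]
  field_simp
  ring

theorem hasFDerivAt_weight (ε b c : ℝ) (hp : p ∈ subparaboloid n) :
    HasFDerivAt (weight ε b c)
      (-(parabolicGauge p ^ (-((1 + ε) / 2)) / parabolicGauge p) •
        (c • ContinuousLinearMap.snd ℝ _ ℝ
          + ((1 + ε) / 2 * b + (3 + ε) / 2 * c * relTime p) • gaugeDeriv p)) p := by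
  have hg : parabolicGauge p ≠ 0 := ne_of_gt hp
  have hprod := ((hasFDerivAt_parabolicGauge p).rpow_const (p := -((1 + ε) / 2)) (Or.inl hg)).mul
    (((hasFDerivAt_relTime hp).const_mul c).const_add b)
  refine hprod.congr_fderiv (ContinuousLinearMap.ext fun v => ?_)
  simp only [add_apply, smul_apply, ContinuousLinearMap.coe_snd', smul_eq_mul,
    Real.rpow_sub_one hg]
  field_simp
  ring

theorem spaceDeriv_weight (ε b c : ℝ) (hp : p ∈ subparaboloid n) (i : Fin n) :
    spaceDeriv i (weight ε b c) p
      = -(parabolicGauge p ^ (-((1 + ε) / 2)) / parabolicGauge p)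
        * ((1 + ε) * b + (3 + ε) * c * relTime p) * p.1 i := by
  rw [spaceDeriv, (hasFDerivAt_weight ε b c hp).fderiv]
  simp only [add_apply, smul_apply, ContinuousLinearMap.coe_snd', smul_eq_mul, gaugeDeriv_apply,
    EuclideanSpace.inner_single_right, Real.ringHom_apply]
  ring

theorem timeDeriv_weight (ε b c : ℝ) (hp : p ∈ subparaboloid n) :
    timeDeriv (weight ε b c) p
      = -(parabolicGauge p ^ (-((1 + ε) / 2)) / parabolicGauge p)
        * (c - (1 + ε) / 2 * b - (3 + ε) / 2 * c * relTime p) := by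
  rw [timeDeriv, (hasFDerivAt_weight ε b c hp).fderiv]
  simp only [add_apply, smul_apply, ContinuousLinearMap.coe_snd', smul_eq_mul, gaugeDeriv_apply,
    inner_zero_right]
  ring

theorem spaceDeriv_solution (ε : ℝ) (hp : p ∈ subparaboloid n) (α i : Fin n) :
    spaceDeriv i (fun q => solution ε q α) p
      = parabolicGauge p ^ (-((1 + ε) / 2)) * gradShape ε p α i := by
  have hmul := spaceDeriv_mul_coord (hasFDerivAt_weight ε 1 2 hp).differentiableAt α i
  rw [spaceDeriv_weight ε 1 2 hp i, weight] at hmul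
  refine hmul.trans ?_
  simp only [gradShape, Matrix.sub_apply, Matrix.smul_apply, Matrix.vecMulVec_apply, smul_eq_mul]
  ring

theorem timeDeriv_solution (hε : 1 + ε ≠ 0) (hp : p ∈ subparaboloid n) (α : Fin n) :
    timeDeriv (fun q => solution ε q α) p = spaceDeriv α (pressure ε) p := by
  have hmul := timeDeriv_mul_coord (hasFDerivAt_weight ε 1 2 hp).differentiableAt α
  refine hmul.trans ?_
  rw [timeDeriv_weight ε 1 2 hp, pressure, spaceDeriv_weight _ _ _ hp, pressureConst]
  field_simp
  ring

theorem trace_gradShape (ε : ℝ) (p : SpaceTime n) :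
    (gradShape ε p).trace = n * (1 + 2 * relTime p)
      - (1 + ε + 2 * (3 + ε) * relTime p) * (‖p.1‖ ^ 2 / parabolicGauge p) := by
  have hvec : p.1.ofLp ⬝ᵥ p.1.ofLp = ‖p.1‖ ^ 2 := by
    rw [EuclideanSpace.real_norm_sq_eq]
    exact Finset.sum_congr rfl fun i _ => (sq _).symm
  rw [gradShape, Matrix.trace_sub, Matrix.trace_smul, Matrix.trace_smul, Matrix.trace_one,
    Matrix.trace_vecMulVec, hvec, Fintype.card_fin, smul_eq_mul, smul_eq_mul]
  ring

theorem trace_gradShape_pos (hn : 2 ≤ n) (h0 : 0 ≤ ε) (h1 : ε < 1 / 3) (hp : p ∈ closedPast n) :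
    0 < (gradShape ε p).trace := by
  have hs := relTime_nonneg hp
  have hn' : (2 : ℝ) ≤ n := by exact_mod_cast hn
  rw [trace_gradShape, sub_pos]
  calc (1 + ε + 2 * (3 + ε) * relTime p) * (‖p.1‖ ^ 2 / parabolicGauge p)
      ≤ (1 + ε + 2 * (3 + ε) * relTime p) * (1 - relTime p) := by
        gcongr
        exact norm_sq_div_parabolicGauge_le p
    _ < 2 * (1 + 2 * relTime p) := by
        nlinarith [sq_nonneg (relTime p - 1 / 8)]
    _ ≤ n * (1 + 2 * relTime p) := by
        gcongr

theorem pressureConst_sub_relTime_pos (h0 : 0 ≤ ε) (h1 : ε < 1 / 3) (hp : p ∈ closedPast n) :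
    0 < pressureConst ε - relTime p := by
  have hconst : 1 < pressureConst ε := by
    rw [pressureConst, one_lt_div (by positivity)]
    linarith
  linarith [relTime_le_one hp]

theorem quadForm_coefficients_pos (hn : 2 ≤ n) (h0 : 0 ≤ ε) (h1 : ε < 1 / 3)
    (hp : p ∈ closedPast n) {ξ : Matrix (Fin n) (Fin n) ℝ} (hξ : ξ ≠ 0) :
    0 < quadForm (coefficients ε p) ξ :=
  have htrace := trace_gradShape_pos hn h0 h1 hp
  quadForm_pressureTensor_pos (div_pos (pressureConst_sub_relTime_pos h0 h1 hp) htrace)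
    htrace.ne' hξ

theorem contDiffOn_coefficients (hn : 2 ≤ n) (h0 : 0 ≤ ε) (h1 : ε < 1 / 3) :
    ContDiffOn ℝ ∞ (coefficients ε) (closedPast n ∩ subparaboloid n) := by
  have hP (α i : Fin n) :
      ContDiffOn ℝ ∞ (fun p => gradShape ε p α i) (closedPast n ∩ subparaboloid n) :=
    (contDiffOn_gradShape ε α i).mono inter_subset_right
  refine contDiffOn_pressureTensor ?_ hP
  exact (contDiffOn_const.sub (contDiffOn_relTime.mono inter_subset_right)).div
    (ContDiffOn.sum fun i _ => hP i i) fun p hp => (trace_gradShape_pos hn h0 h1 hp.1).ne'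

theorem isCompact_image_coefficients (hn : 2 ≤ n) (h0 : 0 ≤ ε) (h1 : ε < 1 / 3) :
    IsCompact (coefficients ε '' closedPast n) :=
  (isParabolicallyHomogeneous_coefficients ε).isCompact_image_closedPast
    (contDiffOn_coefficients hn h0 h1).continuousOn

theorem exists_norm_coefficients_le (hn : 2 ≤ n) (h0 : 0 ≤ ε) (h1 : ε < 1 / 3) :
    ∃ C : ℝ, ∀ p ∈ closedPast n, ‖coefficients ε p‖ ≤ C := by
  simpa only [forall_mem_image] using
    (isCompact_image_coefficients hn h0 h1).isBounded.exists_norm_le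

theorem uniformlyElliptic_coefficients (hn : 2 ≤ n) (h0 : 0 ≤ ε) (h1 : ε < 1 / 3) :
    UniformlyElliptic (coefficients ε) (closedPast n) :=
  uniformlyElliptic_of_isCompact_image (isCompact_image_coefficients hn h0 h1)
    fun _ hp _ hξ => quadForm_coefficients_pos hn h0 h1 hp hξ

theorem isWeakSolution_solution (hn : 2 ≤ n) (h0 : 0 ≤ ε) (h1 : ε < 1 / 3) :
    IsWeakSolution (coefficients (n := n) ε) (solution ε) := by
  have hpast := past_subset_subparaboloid n
  have hpressure : ContDiffOn ℝ 1 (pressure (n := n) ε) (past n) :=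
    ((contDiffOn_weight ε _ _).mono hpast).of_le (by simp)
  refine isWeakSolution_of_classical
    (σ := fun p => pressure ε p • (1 : Matrix (Fin n) (Fin n) ℝ)) (fun α => ?_)
    (fun α i => hpressure.mul contDiffOn_const) (fun p hp α i => ?_) fun p hp α => ?_
  · exact contDiffOn_euclidean.1 (((contDiffOn_solution ε).mono hpast).of_le (by simp)) α
  · have htrace := (trace_gradShape_pos hn h0 h1 (past_subset_closedPast n hp)).ne'
    calc ∑ β, ∑ j, coefficients ε p α β i j * spaceDeriv j (fun q => solution ε q β) p
        = parabolicGauge p ^ (-((1 + ε) / 2))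
            * ∑ β, ∑ j, coefficients ε p α β i j * gradShape ε p β j := by
          simp only [spaceDeriv_solution ε (hpast hp), Finset.mul_sum, mul_left_comm]
      _ = pressure ε p * (1 : Matrix (Fin n) (Fin n) ℝ) α i := by
          rw [coefficients, sum_pressureTensor_mul_self, div_mul_cancel₀ _ htrace, pressure, weight]
          ring
  · rw [timeDeriv_solution (by positivity) (hpast hp)]
    have hdiff : DifferentiableAt ℝ (pressure ε) p :=
      (hasFDerivAt_weight _ _ _ (hpast hp)).differentiableAt
    have hentry (i : Fin n) :
        spaceDeriv i (fun q => pressure ε q * (1 : Matrix (Fin n) (Fin n) ℝ) α i) p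
          = spaceDeriv i (pressure ε) p * (1 : Matrix (Fin n) (Fin n) ℝ) α i := by
      rw [spaceDeriv, fderiv_mul_const hdiff]
      exact mul_comm _ _
    simp only [Matrix.smul_apply, smul_eq_mul, hentry]
    simp [Matrix.one_apply]

theorem solution_ne_zero (ε : ℝ) {x : EuclideanSpace ℝ (Fin n)} (hx : x ≠ 0) {t : ℝ}
    (ht : t ≤ 0) : solution ε (x, t) ≠ 0 := by
  have hg : 0 < parabolicGauge (x, t) :=
    mem_subparaboloid_of_ne_zero ht fun h => hx (congrArg Prod.fst h)
  have hs : 0 ≤ relTime (x, t) := relTime_nonneg ht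
  refine smul_ne_zero (ne_of_gt ?_) hx
  rw [weight]
  positivity

theorem solution_neg (ε : ℝ) (x : EuclideanSpace ℝ (Fin n)) (t : ℝ) :
    solution ε (-x, t) = -solution ε (x, t) := by
  simp [solution, weight, relTime, parabolicGauge]

theorem coefficients_apply_swap (ε : ℝ) (p : SpaceTime n) {i j : Fin n} (hij : i ≠ j) :
    coefficients ε p i j j i
      = -((1 + ε + 2 * (3 + ε) * relTime p) / parabolicGauge p * (p.1 i * p.1 j)) ^ 2 := by
  simp only [coefficients, pressureTensor, gradShape, Matrix.sub_apply, Matrix.smul_apply,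
    Matrix.vecMulVec_apply, Matrix.one_apply_ne hij, Matrix.one_apply_ne hij.symm, smul_eq_mul]
  ring

theorem not_tendsto_coefficients (hn : 2 ≤ n) (h0 : 0 ≤ ε) :
    ¬ ∃ L : Coeff n n, Tendsto (coefficients ε) (𝓝[past n] (0, 0)) (𝓝 L) := by
  rintro ⟨L, hL⟩
  have hconst : ∀ p ∈ past n, coefficients ε p = L := fun p hp =>
    (isParabolicallyHomogeneous_coefficients ε).eq_of_tendsto hL hp
  have : Nontrivial (Fin n) := Fin.nontrivial_iff_two_le.2 hn
  obtain ⟨i, j, hij⟩ := exists_pair_ne (Fin n)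
  have hpast (x : EuclideanSpace ℝ (Fin n)) : (x, (-1 : ℝ)) ∈ past n :=
    (neg_one_lt_zero : (-1 : ℝ) < 0)
  let x : EuclideanSpace ℝ (Fin n) := WithLp.toLp 2 fun _ => 1
  have hg : 0 < parabolicGauge (x, (-1 : ℝ)) := past_subset_subparaboloid n (hpast x)
  have hs : 0 ≤ relTime (x, (-1 : ℝ)) := relTime_nonneg (past_subset_closedPast n (hpast x))
  have haxis := coefficients_apply_swap ε ((0 : EuclideanSpace ℝ (Fin n)), (-1 : ℝ)) hij
  have hdiag := coefficients_apply_swap ε (x, (-1 : ℝ)) hij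
  rw [hconst _ (hpast _)] at haxis hdiag
  have hzero :
      (1 + ε + 2 * (3 + ε) * relTime (x, (-1 : ℝ))) / parabolicGauge (x, (-1 : ℝ)) = 0 := by
    simpa [x, haxis] using hdiag
  exact absurd hzero (by positivity)

end ExplicitSolution

theorem one_div_sq_mul_log_mem_Ico {R : ℝ} (hR : Real.exp 1 ≤ R) :
    1 / (R ^ 2 * Real.log R) ∈ Ico (0 : ℝ) (1 / 3) := by
  have hR2 : 2 ≤ R := by linarith [Real.add_one_le_exp 1]
  have hlog : 1 ≤ Real.log R := (Real.le_log_iff_exp_le (by linarith)).2 hR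
  refine ⟨by positivity, one_div_lt_one_div_of_lt three_pos ?_⟩
  calc (3 : ℝ) < 2 ^ 2 * 1 := by norm_num
    _ ≤ R ^ 2 * Real.log R := by gcongr

end ParabolicSystem

open ParabolicSystem in
theorem mainTheorem4_general {n : ℕ} (hn : 2 ≤ n) {ε : ℝ} (h0 : 0 ≤ ε) (h1 : ε < 1 / 3) :
    ∃ (U : EuclideanSpace ℝ (Fin n) → EuclideanSpace ℝ (Fin n))
      (A : EuclideanSpace ℝ (Fin n) → Coeff n n)
      (u : SpaceTime n → EuclideanSpace ℝ (Fin n))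
      (a : SpaceTime n → Coeff n n),
      ContDiff ℝ ∞ U ∧ (∃ C : ℝ, ∀ y, ‖U y‖ ≤ C) ∧ ContDiff ℝ ∞ A ∧
      (∀ x : EuclideanSpace ℝ (Fin n), ∀ t : ℝ, t < 0 →
        u (x, t) = ((-t) ^ (-(ε / 2)) : ℝ) • U ((√(-t))⁻¹ • x) ∧
        a (x, t) = A ((√(-t))⁻¹ • x)) ∧
      ContDiffOn ℝ ∞ u (past n) ∧
      (∀ δ : ℝ, 0 < δ → ∃ K : NNReal, LipschitzOnWith K u {p | p ∈ closedPast n ∧ δ ≤ ‖p‖}) ∧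
      (∀ p ∈ closedPast n, IsSymmCoeff (a p)) ∧
      (∃ C : ℝ, ∀ p ∈ closedPast n, ‖a p‖ ≤ C) ∧
      UniformlyElliptic a (closedPast n) ∧
      ContDiffOn ℝ ∞ a (past n) ∧
      (¬ ∃ L : Coeff n n, Tendsto a (𝓝[past n] (0, 0)) (𝓝 L)) ∧
      IsWeakSolution a u ∧
      (∃ c C : ℝ, 0 < c ∧ 0 < C ∧ ∀ t ∈ Ico (-1 : ℝ) 0,
        ENNReal.ofReal (c * (-t) ^ (-(ε / 2))) ≤
          eLpNorm (fun x => u (x, t)) ⊤ (volume.restrict (Metric.ball 0 1)) ∧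
        eLpNorm (fun x => u (x, t)) ⊤ (volume.restrict (Metric.ball 0 1)) ≤
          ENNReal.ofReal (C * (-t) ^ (-(ε / 2)))) ∧
      (∀ x : EuclideanSpace ℝ (Fin n), x ≠ 0 → ∀ s : ℝ, 0 < s →
        u (s • x, 0) = (s ^ (-ε) : ℝ) • u (x, 0)) ∧
      (¬ ∃ L : EuclideanSpace ℝ (Fin n),
        Tendsto (fun x => u (x, (0 : ℝ))) (𝓝[≠] 0) (𝓝 L)) := by
  have hu := isParabolicallyHomogeneous_solution (n := n) ε
  have ha := isParabolicallyHomogeneous_coefficients (n := n) ε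
  have hC := contDiffOn_solution (n := n) ε
  have hCpast := hC.mono (past_subset_subparaboloid n)
  have haC := (contDiffOn_coefficients hn h0 h1).mono (past_subset_closedPast_inter_subparaboloid n)
  have hcont := hC.continuousOn.mono (inter_subset_right (s := closedPast n))
  have hd : -ε ≤ 0 := neg_nonpos.2 h0
  obtain ⟨e, he, he1⟩ : ∃ e : EuclideanSpace ℝ (Fin n), e ≠ 0 ∧ e ∈ Metric.ball 0 1 :=
    ⟨EuclideanSpace.single ⟨0, by omega⟩ (1 / 2), by simp,
      by rw [mem_ball_zero_iff, PiLp.norm_single]; norm_num⟩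
  refine ⟨fun y => solution ε (y, -1), fun y => coefficients ε (y, -1), solution ε, coefficients ε,
    contDiff_slice neg_one_lt_zero hCpast, hu.exists_norm_slice_le hd hcont,
    contDiff_slice neg_one_lt_zero haC, fun x t ht => ⟨?_, ?_⟩, hCpast,
    fun δ hδ => hu.exists_lipschitzOnWith hd (hC.of_le (by simp)) hδ,
    fun p _ => isSymmCoeff_pressureTensor _ _, exists_norm_coefficients_le hn h0 h1,
    uniformlyElliptic_coefficients hn h0 h1, haC, not_tendsto_coefficients hn h0,
    isWeakSolution_solution hn h0 h1, ?_, fun x hx s hs => hu.smul_initial hx hs,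
    hu.not_tendsto_initial_of_odd hd (solution_neg ε · 0) he (solution_ne_zero ε he le_rfl)⟩
  · rw [hu.eq_self_similar x ht, neg_div]
  · rw [ha.eq_self_similar x ht, zero_div, Real.rpow_zero, one_smul]
  · rw [← neg_div]
    exact hu.exists_eLpNorm_ball_bounds hd hcont he1 (solution_ne_zero ε he neg_one_lt_zero.le)

open ParabolicSystem in
theorem mainTheorem4 :
    ∃ Rstar : ℝ, 1 < Rstar ∧ ∀ R₀ : ℝ, Rstar ≤ R₀ → ∀ ε : ℝ, ε = 1 / (R₀ ^ 2 * Real.log R₀) →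
    ∃ (U : EuclideanSpace ℝ (Fin 2) → EuclideanSpace ℝ (Fin 2))
      (A : EuclideanSpace ℝ (Fin 2) → Coeff 2 2)
      (u : SpaceTime 2 → EuclideanSpace ℝ (Fin 2))
      (a : SpaceTime 2 → Coeff 2 2),
      -- the profile is smooth and bounded, its coefficients are smooth
      ContDiff ℝ ∞ U ∧ (∃ C : ℝ, ∀ y, ‖U y‖ ≤ C) ∧ ContDiff ℝ ∞ A ∧
      -- self-similar form of the solution and of the coefficients
      (∀ x : EuclideanSpace ℝ (Fin 2), ∀ t : ℝ, t < 0 →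
        u (x, t) = ((-t) ^ (-(ε / 2)) : ℝ) • U ((√(-t))⁻¹ • x) ∧
        a (x, t) = A ((√(-t))⁻¹ • x)) ∧
      -- `u` is smooth for `t < 0` and Lipschitz up to `t = 0` away from `(0, 0)`
      ContDiffOn ℝ ∞ u (past 2) ∧
      (∀ δ : ℝ, 0 < δ → ∃ K : NNReal, LipschitzOnWith K u {p | p ∈ closedPast 2 ∧ δ ≤ ‖p‖}) ∧
      -- `a` is symmetric, bounded, uniformly elliptic, and smooth for `t < 0`
      (∀ p ∈ closedPast 2, IsSymmCoeff (a p)) ∧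
      (∃ C : ℝ, ∀ p ∈ closedPast 2, ‖a p‖ ≤ C) ∧
      UniformlyElliptic a (closedPast 2) ∧
      ContDiffOn ℝ ∞ a (past 2) ∧
      -- `a` is essentially discontinuous at `(0, 0)`
      (¬ ∃ L : Coeff 2 2, Tendsto a (𝓝[past 2] (0, 0)) (𝓝 L)) ∧
      -- `u` solves the system
      IsWeakSolution a u ∧
      -- the `L^∞` norm on the unit ball blows up at the rate `(-t)^{-ε/2}`
      (∃ c C : ℝ, 0 < c ∧ 0 < C ∧ ∀ t ∈ Ico (-1 : ℝ) 0,
        ENNReal.ofReal (c * (-t) ^ (-(ε / 2))) ≤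
          eLpNorm (fun x => u (x, t)) ⊤ (volume.restrict (Metric.ball 0 1)) ∧
        eLpNorm (fun x => u (x, t)) ⊤ (volume.restrict (Metric.ball 0 1)) ≤
          ENNReal.ofReal (C * (-t) ^ (-(ε / 2)))) ∧
      -- `u(·, 0)` is homogeneous of degree `-ε`, and discontinuous at the origin
      (∀ x : EuclideanSpace ℝ (Fin 2), x ≠ 0 → ∀ s : ℝ, 0 < s →
        u (s • x, 0) = (s ^ (-ε) : ℝ) • u (x, 0)) ∧
      (¬ ∃ L : EuclideanSpace ℝ (Fin 2),
        Tendsto (fun x => u (x, (0 : ℝ))) (𝓝[≠] 0) (𝓝 L)) :=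
  ⟨Real.exp 1, Real.one_lt_exp_iff.2 one_pos, fun _ hR _ hε => hε ▸
    have hmem := one_div_sq_mul_log_mem_Ico hR
    mainTheorem4_general le_rfl hmem.1 hmem.2⟩
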